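/- Let $G$ be a finite group and let $\gamma_1$ and $\gamma_2$ be two actions of $G$ on the sphere $S^3$ by homeomorphisms, written $(g,x) \mapsto g\cdot_1 x$ and $(g,x)\mapsto g\cdot_2 x$. Suppose that $\gamma_1$ is free, that is, $g \cdot_1 x \neq x$ for all $x \in S^3$ and all $g \in G$ with $g \neq 1$. Then there is a continuous map $f : S^3 \to S^3$ such that $$f(g\cdot_1 x) = g \cdot_2 f(x) \qquad \text{for all } g\in G \text{ and all } x\in S^3.$$ -/

import Mathlib

/-- The unit sphere `S³` of Euclidean `4`-space. -/
abbrev S3 : Type := Metric.sphere (0 : EuclideanSpace ℝ (Fin 4)) 1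

/-- A (continuous, left) action of a discrete group `G` on a topological space `X`: a group
homomorphism from `G` to the group of self-homeomorphisms of `X` under composition. -/
abbrev TopAction (G X : Type*) [Group G] [TopologicalSpace X] := G →* (X ≃ₜ X)

/-- The action is free: no element other than the identity fixes a point. -/
def TopAction.IsFree {G X : Type*} [Group G] [TopologicalSpace X] (γ : TopAction G X) : Prop :=
  ∀ g : G, ∀ x : X, γ g x = x → g = 1

open Set Metric Topology Module

/-! Maps from closed subsets of the sphere to the sphere extend, since a smooth image of the sphere
in `E` has empty interior and so can be pushed off `0`. By freeness and compactness, finitely many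
closed sets `B`, each with pairwise disjoint translates, have translates covering the sphere. The
map is built one `B` at a time: extend it to `B` ignoring the action, then let equivariance dictate
it on the translates of `B`. Nothing is asked of the second action. -/

theorem dimH_sphere_lt_finrank {E : Type*} [NormedAddCommGroup E] [InnerProductSpace ℝ E]
    [FiniteDimensional ℝ E] [Nontrivial E] :
    dimH (sphere (0 : E) 1) < finrank ℝ E := by
  obtain ⟨v, hv⟩ := exists_norm_eq E (zero_le_one' ℝ)
  have hv0 : v ≠ 0 := norm_ne_zero_iff.1 (by simp [hv])
  have hlt : finrank ℝ (ℝ ∙ v)ᗮ < finrank ℝ E := by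
    refine Submodule.finrank_lt fun h => hv0 ?_
    rw [Submodule.orthogonal_eq_top_iff] at h
    simpa using h
  have hsmooth : ContDiff ℝ 1 fun w : (ℝ ∙ v)ᗮ => stereoInvFunAux v (w : E) :=
    contDiff_stereoInvFunAux.comp (ℝ ∙ v)ᗮ.subtypeL.contDiff
  -- Inverse stereographic projection from `v` covers all but `v` by a smooth image of a hyperplane.
  have hsub : sphere (0 : E) 1 ⊆
      {v} ∪ range fun w : (ℝ ∙ v)ᗮ => stereoInvFunAux v (w : E) := by
    intro x hx
    by_cases hxv : x = v
    · exact Or.inl hxv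
    · exact Or.inr ⟨stereoToFun v x,
        congrArg Subtype.val (stereo_left_inv hv (x := ⟨x, hx⟩) hxv)⟩
  calc dimH (sphere (0 : E) 1)
      ≤ dimH ({v} ∪ range fun w : (ℝ ∙ v)ᗮ => stereoInvFunAux v (w : E)) := dimH_mono hsub
    _ ≤ finrank ℝ (ℝ ∙ v)ᗮ := by
        rw [dimH_union, dimH_singleton]
        exact max_le zero_le hsmooth.dimH_range_le
    _ < finrank ℝ E := by exact_mod_cast hlt

/-- On the unit sphere, a continuous function `E → E` can be uniformly approximated by
continuous functions that vanish nowhere on the sphere. -/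
theorem exists_continuous_ne_zero_norm_sub_lt {E : Type*} [NormedAddCommGroup E]
    [InnerProductSpace ℝ E] [FiniteDimensional ℝ E] [Nontrivial E] (F : C(E, E)) {ε : ℝ}
    (hε : 0 < ε) :
    ∃ K : E → E, Continuous K ∧ ∀ x ∈ sphere (0 : E) 1, K x ≠ 0 ∧ ‖K x - F x‖ < ε := by
  have hdense := (ContinuousMap.dense_setOfPred_contDiff (E := E) (F := E)) F
  rw [mem_closure_iff_nhds_basis
    (nhds_basis_uniformity Metric.uniformity_basis_dist.compactConvergenceUniformity)] at hdense
  obtain ⟨H, hH, hHF⟩ := hdense (sphere (0 : E) 1, ε / 2) ⟨isCompact_sphere 0 1, half_pos hε⟩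
  have hHs : ContDiff ℝ 1 H := ContDiff.of_le (mem_ofPred_eq ▸ hH) (by exact_mod_cast le_top)
  have hcompl : Dense (H '' sphere (0 : E) 1)ᶜ :=
    hHs.contDiffOn.dense_compl_image_of_dimH_lt_finrank convex_univ (subset_univ _)
      dimH_sphere_lt_finrank
  -- Subtracting a small value `p` that `H` misses on the sphere removes the zeros of `H` there.
  obtain ⟨p, hp, hpε⟩ := hcompl.exists_dist_lt 0 (half_pos hε)
  refine ⟨fun x => H x - p, by fun_prop, fun x hx => ⟨fun h => hp ⟨x, hx, sub_eq_zero.1 h⟩, ?_⟩⟩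
  have h1 : ‖H x - F x‖ < ε / 2 := by
    have := hHF x hx
    simpa [dist_eq_norm] using this
  have h2 : ‖p‖ < ε / 2 := by simpa using hpε
  calc ‖H x - p - F x‖ = ‖(H x - F x) - p‖ := by congr 1; abel
    _ ≤ ‖H x - F x‖ + ‖p‖ := norm_sub_le _ _
    _ < ε := by linarith

/-- The unit sphere is an absolute extensor for itself. -/
theorem exists_continuous_sphere_extension {E : Type*} [NormedAddCommGroup E]
    [InnerProductSpace ℝ E] [FiniteDimensional ℝ E] [Nontrivial E]
    {A : Set (sphere (0 : E) 1)} (hA : IsClosed A)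
    {φ : sphere (0 : E) 1 → sphere (0 : E) 1} (hφ : ContinuousOn φ A) :
    ∃ h : sphere (0 : E) 1 → sphere (0 : E) 1, Continuous h ∧ EqOn h φ A := by
  let φA : C(A, E) := ⟨fun a => (φ a : E), continuous_subtype_val.comp hφ.domRestrict⟩
  have hemb : IsClosedEmbedding fun a : A => ((a : sphere (0 : E) 1) : E) :=
    isClosed_sphere.isClosedEmbedding_subtypeVal.comp hA.isClosedEmbedding_subtypeVal
  obtain ⟨F, hF⟩ := φA.exists_extension' hemb
  have hFA (a) (ha : a ∈ A) : F (a : E) = φ a := congrFun hF ⟨a, ha⟩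
  -- Any bound in `(0, 1)` would do: `‖F‖ = 1` on `A`, which leaves room for a cutoff `c` equal to
  -- `0` where `‖F‖ ≤ 3 / 4` and to `1` on `A`.
  obtain ⟨K, hK, hKF⟩ := exists_continuous_ne_zero_norm_sub_lt F (ε := 3 / 4) (by norm_num)
  -- Interpolate from `K` to `F`, using only points where the connecting segment avoids `0`.
  let c : E → ℝ := fun x => max 0 (min 1 (4 * ‖F x‖ - 3))
  let L : E → E := fun x => K x + c x • (F x - K x)
  have hL : Continuous L := by fun_prop
  have hL0 (x : sphere (0 : E) 1) : L x ≠ 0 := by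
    obtain ⟨hK0, hlt⟩ := hKF x x.2
    intro h0
    by_cases hx : ‖F x‖ ≤ 3 / 4
    · have hc : c x = 0 := max_eq_left ((min_le_right _ _).trans (by linarith))
      simp only [L, hc, zero_smul, add_zero] at h0
      exact hK0 h0
    · have hc0 : 0 ≤ c x := le_max_left _ _
      have hc1 : c x ≤ 1 := max_le zero_le_one (min_le_left _ _)
      have hFx : F x = -((1 - c x) • (K x - F x)) := by
        have : L x = F x + (1 - c x) • (K x - F x) := by simp only [L]; module
        rw [this] at h0
        exact eq_neg_of_add_eq_zero_left h0
      have hle : ‖F x‖ ≤ ‖K x - F x‖ := by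
        conv_lhs => rw [hFx]
        rw [norm_neg, norm_smul, Real.norm_of_nonneg (by linarith)]
        exact mul_le_of_le_one_left (norm_nonneg _) (by linarith)
      linarith
  refine ⟨fun x => ⟨‖L x‖⁻¹ • L x, by
    simp [norm_smul, inv_mul_cancel₀ (norm_ne_zero_iff.2 (hL0 x))]⟩, ?_, fun a ha => ?_⟩
  · refine Continuous.subtype_mk (Continuous.smul (Continuous.inv₀ ?_ fun x =>
      norm_ne_zero_iff.2 (hL0 x)) ?_) _
    · exact (hL.comp continuous_subtype_val).norm
    · exact hL.comp continuous_subtype_val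
  · have hn : ‖(φ a : E)‖ = 1 := norm_eq_of_mem_sphere _
    have hc : c a = 1 := by simp only [c, hFA a ha, hn]; norm_num
    have hLa : L a = φ a := by simp [L, hc, hFA a ha]
    ext1
    simp [hLa]

namespace TopAction

variable {G X Y : Type*} [Group G] [TopologicalSpace X] [TopologicalSpace Y]

theorem map_mul_apply (γ : TopAction G X) (g k : G) (x : X) : γ (g * k) x = γ g (γ k x) := by
  rw [map_mul]; rfl

theorem map_one_apply (γ : TopAction G X) (x : X) : γ 1 x = x := by
  rw [map_one]; rfl

/-- The union of the translates of `B`. -/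
def saturation (γ : TopAction G X) (B : Set X) : Set X := ⋃ g : G, γ g ⁻¹' B

theorem mem_saturation {γ : TopAction G X} {B : Set X} {x : X} :
    x ∈ γ.saturation B ↔ ∃ g, γ g x ∈ B := by simp [saturation]

theorem apply_mem_saturation {γ : TopAction G X} {B : Set X} {x : X} (g : G)
    (hx : x ∈ γ.saturation B) : γ g x ∈ γ.saturation B := by
  obtain ⟨k, hk⟩ := mem_saturation.1 hx
  refine mem_saturation.2 ⟨k * g⁻¹, ?_⟩
  rwa [← map_mul_apply, inv_mul_cancel_right]

theorem isClosed_saturation [Finite G] (γ : TopAction G X) {B : Set X} (hB : IsClosed B) :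
    IsClosed (γ.saturation B) :=
  isClosed_iUnion_of_finite fun g => hB.preimage (γ g).continuous

/-- A free action of a finite group on a regular Hausdorff space is a covering space action. -/
theorem IsFree.exists_isClosed_mem_nhds [Finite G] [T3Space X] {γ : TopAction G X}
    (hγ : γ.IsFree) (x : X) :
    ∃ B ∈ 𝓝 x, IsClosed B ∧ ∀ g, ∀ y ∈ B, γ g y ∈ B → g = 1 := by
  have h (g : G) : ∃ U ∈ 𝓝 x, ∀ y ∈ U, γ g y ∈ U → g = 1 := by
    by_cases hg : g = 1
    · exact ⟨univ, Filter.univ_mem, fun _ _ _ => hg⟩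
    · obtain ⟨u, v, hu, hv, hxu, hxv, huv⟩ :=
        t2_separation fun h : γ g x = x => hg (hγ g x h)
      -- `g` carries this neighbourhood into `u`, which is disjoint from `v`.
      exact ⟨v ∩ γ g ⁻¹' u, Filter.inter_mem (hv.mem_nhds hxv)
        ((hu.preimage (γ g).continuous).mem_nhds hxu),
        fun y hy hgy => (disjoint_left.1 huv hy.2 hgy.1).elim⟩
  choose U hU hUg using h
  obtain ⟨B, hB, hBc, hBU⟩ := exists_mem_nhds_isClosed_subset (Filter.iInter_mem.2 hU)
  exact ⟨B, hB, hBc, fun g y hy hgy =>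
    hUg g y (mem_iInter.1 (hBU hy) g) (mem_iInter.1 (hBU hgy) g)⟩

/-- An equivariant map on a closed invariant set `A` extends over the translates of a closed set
`B` whose translates are pairwise disjoint. -/
theorem exists_equivariant_extension_union [Finite G] (γ₁ : TopAction G X) (γ₂ : TopAction G Y)
    (hext : ∀ (A : Set X) (φ : X → Y), IsClosed A → ContinuousOn φ A →
      ∃ h : X → Y, Continuous h ∧ EqOn h φ A)
    {A B : Set X} (hA : IsClosed A) (hB : IsClosed B) (hAinv : ∀ g, ∀ x ∈ A, γ₁ g x ∈ A)
    (hBdisj : ∀ g, ∀ y ∈ B, γ₁ g y ∈ B → g = 1) {f : X → Y} (hf : ContinuousOn f A)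
    (hfeq : ∀ g, ∀ x ∈ A, f (γ₁ g x) = γ₂ g (f x)) :
    ∃ f' : X → Y, ContinuousOn f' (A ∪ γ₁.saturation B) ∧
      ∀ g, ∀ x ∈ A ∪ γ₁.saturation B, f' (γ₁ g x) = γ₂ g (f' x) := by
  classical
  obtain ⟨h, hh, hhf⟩ := hext A f hA hf
  -- The chosen `g` is unique because the translates of `B` are disjoint; on `A` both formulas agree
  -- because `f` is equivariant there.
  let f' : X → Y := fun x =>
    if hx : ∃ g, γ₁ g x ∈ B then γ₂ hx.choose⁻¹ (h (γ₁ hx.choose x)) else f x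
  have hf'B {g : G} {x : X} (hgx : γ₁ g x ∈ B) : f' x = γ₂ g⁻¹ (h (γ₁ g x)) := by
    have hx : ∃ g, γ₁ g x ∈ B := ⟨g, hgx⟩
    have hg : hx.choose = g := by
      refine mul_inv_eq_one.1 (hBdisj _ _ hgx ?_)
      rw [← map_mul_apply, inv_mul_cancel_right]
      exact hx.choose_spec
    simp only [f', dif_pos hx, hg]
  have hf'A {x : X} (hx : x ∈ A) : f' x = f x := by
    by_cases hxB : ∃ g, γ₁ g x ∈ B
    · obtain ⟨g, hg⟩ := hxB
      rw [hf'B hg, hhf (hAinv g x hx), hfeq g x hx, ← map_mul_apply, inv_mul_cancel,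
        map_one_apply]
    · simp only [f', dif_neg hxB]
  refine ⟨f', (hf.congr fun x hx => hf'A hx).union_of_isClosed ?_ hA
    (γ₁.isClosed_saturation hB), ?_⟩
  · refine (locallyFinite_of_finite _).continuousOn_iUnion
      (fun g => hB.preimage (γ₁ g).continuous) fun g => ?_
    have : Continuous fun x => γ₂ g⁻¹ (h (γ₁ g x)) :=
      (γ₂ g⁻¹).continuous.comp (hh.comp (γ₁ g).continuous)
    exact this.continuousOn.congr fun x hx => hf'B hx
  · rintro g x (hx | hx)
    · rw [hf'A hx, hf'A (hAinv g x hx), hfeq g x hx]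
    · obtain ⟨k, hk⟩ := mem_saturation.1 hx
      have hk' : γ₁ (k * g⁻¹) (γ₁ g x) = γ₁ k x := by
        rw [← map_mul_apply, inv_mul_cancel_right]
      rw [hf'B (hk'.symm ▸ hk), hf'B hk, hk', mul_inv_rev, inv_inv, map_mul_apply]

/-- If `X` is a compact Hausdorff space with a free action of a finite group `G`, and maps to `Y`
extend from closed subsets of `X`, then `X` has an equivariant map to `Y` for any `G`-action on
`Y`. -/
theorem IsFree.exists_equivariant [Finite G] [CompactSpace X] [T2Space X] [Nonempty Y]
    {γ₁ : TopAction G X} (hfree : γ₁.IsFree) (γ₂ : TopAction G Y)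
    (hext : ∀ (A : Set X) (φ : X → Y), IsClosed A → ContinuousOn φ A →
      ∃ h : X → Y, Continuous h ∧ EqOn h φ A) :
    ∃ f : C(X, Y), ∀ (g : G) (x : X), f (γ₁ g x) = γ₂ g (f x) := by
  choose B hBx hBc hBdisj using hfree.exists_isClosed_mem_nhds
  obtain ⟨t, ht⟩ := finite_cover_nhds hBx
  let S (s : Finset X) : Set X := ⋃ x ∈ s, γ₁.saturation (B x)
  have hSc (s : Finset X) : IsClosed (S s) :=
    isClosed_biUnion_finset fun x _ => γ₁.isClosed_saturation (hBc x)
  have hSinv (s : Finset X) (g : G) : ∀ x ∈ S s, γ₁ g x ∈ S s := by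
    intro x hx
    obtain ⟨y, hy, hxy⟩ := mem_iUnion₂.1 hx
    exact mem_iUnion₂.2 ⟨y, hy, apply_mem_saturation g hxy⟩
  have key (s : Finset X) :
      ∃ f : X → Y, ContinuousOn f (S s) ∧ ∀ g, ∀ x ∈ S s, f (γ₁ g x) = γ₂ g (f x) := by
    classical
    induction s using Finset.induction_on with
    | empty => exact ⟨fun _ => Classical.arbitrary Y, by simp [S], by simp [S]⟩
    | insert a s _ ih =>
      obtain ⟨f, hf, hfeq⟩ := ih
      have hS : S (insert a s) = S s ∪ γ₁.saturation (B a) := by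
        simp only [S, Finset.set_biUnion_insert, union_comm]
      rw [hS]
      exact exists_equivariant_extension_union γ₁ γ₂ hext (hSc s) (hBc a) (hSinv s)
        (hBdisj a) hf hfeq
  have hSt : S t = univ := by
    refine eq_univ_of_forall fun x => ?_
    obtain ⟨y, hy, hxy⟩ := mem_iUnion₂.1 (ht.symm ▸ mem_univ x)
    exact mem_iUnion₂.2 ⟨y, hy, mem_saturation.2 ⟨1, by rwa [map_one_apply]⟩⟩
  obtain ⟨f, hf, hfeq⟩ := key t
  rw [hSt] at hf hfeq
  exact ⟨⟨f, continuousOn_univ.1 hf⟩, fun g x => hfeq g x (mem_univ x)⟩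

end TopAction

theorem proposition7 {G : Type*} [Group G] [Finite G] (γ₁ γ₂ : TopAction G S3)
    (hfree : TopAction.IsFree γ₁) :
    ∃ f : C(S3, S3), ∀ (g : G) (x : S3), f (γ₁ g x) = γ₂ g (f x) := by
  have : Nonempty S3 := (NormedSpace.sphere_nonempty.2 zero_le_one).to_subtype
  exact hfree.exists_equivariant γ₂ fun _ _ hA hφ => exists_continuous_sphere_extension hA hφ
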